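/- **Setting.** A general Markov decision process (gMDP) $\mathbf M=(\mathbb X,\mathbb U,\mathbb Y,x_0,\mathbf t,h)$ consists of Polish state and input spaces $\mathbb X,\mathbb U$, a metric output space $(\mathbb Y,\mathbf d_{\mathbb Y})$, an initial state $x_0$, a Borel stochastic kernel $\mathbf t(\cdot\mid x,u)$ on $\mathbb X$ and a measurable output map $h:\mathbb X\to\mathbb Y$. For a probability measure $\nu$ on $\mathbb U$ put $\mathbf t(\cdot\mid x,\nu)=\int\mathbf t(\cdot\mid x,u)\,\nu(du)$. Let $AP$ be a finite set of atomic propositions, $\mathsf L:\mathbb Y\to 2^{AP}$ a measurable labelling, $\psi$ a syntactically co-safe LTL formula over $AP$ (built from $p,\neg p,\wedge,\vee,\bigcirc,\mathsf U$), and $\mathcal A_\psi=(Q,q_0,2^{AP},F,\tau)$ a finite deterministic automaton such that an infinite word $\boldsymbol\omega$ satisfies $\psi$ if and only if the run of $\mathcal A_\psi$ on some finite prefix of $\boldsymbol\omega$ ends in $F$. The product $\mathbf M\otimes\mathcal A_\psi$ is the gMDP with states $\mathbb X\times Q$, initial state $(x_0,\tau(q_0,\mathsf L(h(x_0))))$,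 and transitions $(x,q)\to(x',\tau(q,\mathsf L(h(x'))))$ with $x'\sim\mathbf t(\cdot\mid x,u)$. **Control strategies.** A control strategy $\mathbf C$ for $\mathbf M$ consists of a Polish memory space $\mathbb X_{\mathbf C}$, an initial memory state $x_{\mathbf C0}$, a universally measurable kernel $\mathbf t_{\mathbf C}(\cdot\mid x_{\mathbf C},x)$ on $\mathbb X_{\mathbf C}$ and a universally measurable map $h_{\mathbf C}$ from $\mathbb X_{\mathbf C}$ to the probability measures on $\mathbb U$. The execution $(x_t,x_{\mathbf C,t})_{t\ge0}$ of $\mathbf C\times\mathbf M$ starts in $(x_0,x_{\mathbf C0})$, and given the past, $x_{\mathbf C,t+1}\sim\mathbf t_{\mathbf C}(\cdot\mid x_{\mathbf C,t},x_t)$, $u_t\sim h_{\mathbf C}(x_{\mathbf C,t+1})$, $x_{t+1}\sim\mathbf t(\cdot\mid x_t,u_t)$; $\mathbb P_{\mathbf C\times\mathbf M}$ is its law on $(\mathbb X\times\mathbb X_{\mathbf C})^{\mathbb N}$. **Simulation.** Let $\varepsilon,\delta\ge0$ and let $\widehat{\mathbf M}=(\hat{\mathbb X},\hat{\mathbb U},\mathbb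 Y,\hat x_0,\hat{\mathbf t},\hat h)$ and $\mathbf M=(\mathbb X,\mathbb U,\mathbb Y,x_0,\mathbf t,h)$ be gMDPs with the same metric output space. Then $\widehat{\mathbf M}\preceq^\delta_\varepsilon\mathbf M$ means that there are a universally measurable interface function $\mathcal U_v$ from $\hat{\mathbb U}\times\hat{\mathbb X}\times\mathbb X$ to the probability measures on $\mathbb U$, a measurable relation $\mathcal R\subseteq\hat{\mathbb X}\times\mathbb X$ and a Borel stochastic kernel $\mathbb W(\cdot\mid\hat u,\hat x,x)$ on $\hat{\mathbb X}\times\mathbb X$ such that $(\hat x_0,x_0)\in\mathcal R$ and, for all $(\hat x,x)\in\mathcal R$: $\mathbf d_{\mathbb Y}(\hat h(\hat x),h(x))\le\varepsilon$, and for all $\hat u\in\hat{\mathbb U}$ the measure $\mathbb W(\cdot\mid\hat u,\hat x,x)$ has marginals $\hat{\mathbf t}(\cdot\mid\hat x,\hat u)$ and $\mathbf t(\cdot\mid x,\mathcal U_v(\hat u,\hat x,x))$ and gives $\mathcal R$ mass at least $1-\delta$. **Robust satisfaction probability.** Let a stationary Markov policy on $\widehat{\mathbf M}\otimes\mathcal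 A_\psi$ be given by a universally measurable map $\mu$ from $\hat{\mathbb X}\times Q$ to the probability measures on $\hat{\mathbb U}$. Put $\bar\tau(q,\hat x)=\{\tau(q,\mathsf L(y)) : y\in\mathbb Y,\ \mathbf d_{\mathbb Y}(y,\hat h(\hat x))\le\varepsilon\}$ and, for $V:\hat{\mathbb X}\times Q\to[0,1]$, $$\mathbf T^{\mu}_{\varepsilon,\delta}(V)(\hat x,q)=\min\Big\{1,\max\Big\{0,\int_{\hat{\mathbb X}}\min_{q'\in\bar\tau(q,\hat x')}\max\{\mathbf 1_F(q'),V(\hat x',q')\}\,\hat{\mathbf t}(d\hat x'\mid\hat x,\mu(\hat x,q))-\delta\Big\}\Big\}.$$ The integral is understood as a lower integral if $\mathbb Y$ is such that the integrand is not measurable; for Polish $\mathbb Y$ it is universally measurable. Let $V^\mu_\infty=\lim_{l\to\infty}(\mathbf T^\mu_{\varepsilon,\delta})^l(0)$, a pointwise limit of an increasing sequence, and $$\mathcal S^{\mu}_{\varepsilon,\delta}=\min_{\bar q_0\in\bar\tau(q_0,\hat x_0)}\max\{\mathbf 1_F(\bar q_0),V^\mu_\infty(\hat x_0,\bar q_0)\}.$$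 **Theorem.** Let $\widehat{\mathbf M}$, $\mathsf L$, $\psi$, $\mathcal A_\psi$, $\varepsilon,\delta\ge0$ and a stationary Markov policy $\mu$ on $\widehat{\mathbf M}\otimes\mathcal A_\psi$ be given. Then for every gMDP $\mathbf M$ with $\widehat{\mathbf M}\preceq^\delta_\varepsilon\mathbf M$ there exists a control strategy $\mathbf C$ for $\mathbf M$ such that $$\mathbb P_{\mathbf C\times\mathbf M}\big(\{\mathsf L(h(x_t))\}_{t\ge0}\models\psi\big)\ \ge\ \mathcal S^{\mu}_{\varepsilon,\delta}.$$ -/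

import Mathlib

open MeasureTheory ProbabilityTheory Filter Topology
open scoped ENNReal NNReal

universe u

/-! ### Universally measurable maps -/

/-- A map is universally measurable if it is measurable with respect to the completion of every
probability measure on the domain. For codomains with a countably generated σ-algebra (standard
Borel spaces, and the space of probability measures on a standard Borel space) this says exactly
that it agrees almost everywhere with a measurable map, for every probability measure. -/
def UniversallyMeasurable {α β : Type*} [MeasurableSpace α] [MeasurableSpace β] (f : α → β) :
    Prop :=
  ∀ m : Measure α, IsProbabilityMeasure m → AEMeasurable f m

lemma UniversallyMeasurable.comp {α β γ : Type*} [MeasurableSpace α] [MeasurableSpace β]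
    [MeasurableSpace γ] {f : β → γ} (hf : UniversallyMeasurable f) {g : α → β}
    (hg : Measurable g) : UniversallyMeasurable (f ∘ g) := fun m _ =>
  (hf (m.map g) (Measure.isProbabilityMeasure_map hg.aemeasurable)).comp_measurable hg

lemma UniversallyMeasurable.bind {α β γ : Type*} [MeasurableSpace α] [MeasurableSpace β]
    [MeasurableSpace γ] {κ : α → ProbabilityMeasure β} (hκ : UniversallyMeasurable κ)
    {f : α × β → Measure γ} (hf : UniversallyMeasurable f) :
    UniversallyMeasurable (fun a => (κ a : Measure β).bind fun b => f (a, b)) := by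
  intro m hm
  obtain ⟨g, hg, hκg⟩ := hκ m hm
  let K : Kernel α β := ⟨fun a => (g a : Measure β), measurable_subtype_coe.comp hg⟩
  have hK : IsMarkovKernel K := ⟨fun a => inferInstanceAs (IsProbabilityMeasure (g a : Measure β))⟩
  obtain ⟨f', hf', hff'⟩ := hf (m ⊗ₘ K) inferInstance
  refine ⟨fun a => (K a).bind fun b => f' (a, b), ?_, ?_⟩
  · refine Measure.measurable_of_measurable_coe _ fun s hs => ?_
    have : ∀ a, ((K a).bind fun b => f' (a, b)) s = ∫⁻ b, f' (a, b) s ∂K a := fun a =>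
      Measure.bind_apply hs (hf'.comp measurable_prodMk_left).aemeasurable
    simp_rw [this]
    exact Measurable.lintegral_kernel_prod_right' (f := fun p => f' p s)
      ((Measure.measurable_coe hs).comp hf')
  · filter_upwards [hκg, Measure.ae_ae_of_ae_compProd hff'] with a h1 h2
    have h3 : (κ a : Measure β) = K a := by rw [h1]; rfl
    rw [h3]
    unfold Measure.bind
    rw [Measure.map_congr h2]

/-! ### General Markov decision processes -/

/-- A gMDP with state space `X`, input space `U` and output space `Y`. The topological (Polish)
structure on `X` and `U` and the metric on `Y` are carried by the types. -/
structure GMDP (X U Y : Type*) [MeasurableSpace X] [MeasurableSpace U] [MeasurableSpace Y] where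
  /-- initial state -/
  x0 : X
  /-- conditional stochastic kernel `t(· | x, u)` -/
  t : Kernel (X × U) X
  /-- `t(· | x, u)` is a probability measure -/
  isMarkov : IsMarkovKernel t
  /-- output map -/
  h : X → Y
  measurable_h : Measurable h

namespace GMDP

variable {X U Y : Type*} [MeasurableSpace X] [MeasurableSpace U] [MeasurableSpace Y]

/-- The distribution `t(· | x, ν) = ∫ t(· | x, u) ν(du)` of the next state when the input is drawn
from the probability measure `ν`. -/
noncomputable def next (M : GMDP X U Y) (x : X) (ν : ProbabilityMeasure U) : Measure X :=
  (ν : Measure U).bind fun u => M.t (x, u)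

end GMDP

/-! ### Control strategies and the controlled gMDP -/

/-- A control strategy for a gMDP with state space `X` and input space `U`: a gMDP with its own
Polish state space (memory), with input space `X`, with output space the probability measures on
`U`, and with universally measurable kernel and output map. -/
structure ControlStrategy (X U : Type u) [MeasurableSpace X] [MeasurableSpace U] where
  /-- memory states -/
  XC : Type u
  [top : TopologicalSpace XC]
  [polish : PolishSpace XC]
  [meas : MeasurableSpace XC]
  [borel : BorelSpace XC]
  /-- initial memory state -/
  init : XC
  /-- memory kernel `t_C(· | x_C, x)` -/
  trans : XC × X → ProbabilityMeasure XC
  universallyMeasurable_trans : UniversallyMeasurable trans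
  /-- output map -/
  out : XC → ProbabilityMeasure U
  universallyMeasurable_out : UniversallyMeasurable out

attribute [instance] ControlStrategy.top ControlStrategy.polish ControlStrategy.meas
  ControlStrategy.borel

namespace ControlStrategy

variable {X U : Type u} {Y : Type*} [MeasurableSpace X] [MeasurableSpace U] [MeasurableSpace Y]

/-- One step of the controlled gMDP `C × M` from `(x, c)`: the memory is updated by
`c' ∼ t_C(· | c, x)`, an input `u ∼ h_C(c')` is drawn, and the state moves to `x' ∼ t(· | x, u)`. -/
noncomputable def step (C : ControlStrategy X U) (M : GMDP X U Y) (s : X × C.XC) :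
    Measure (X × C.XC) :=
  (C.trans (s.2, s.1) : Measure C.XC).bind fun c' =>
    (C.out c' : Measure U).bind fun u => (M.t (s.1, u)).map fun x' => (x', c')

/-- `P` is the law of the execution `(x_t, x_{C,t})_{t ∈ ℕ}` of the controlled gMDP `C × M` on the
canonical sample space `(X × X_C)^ℕ`: it starts in `(x_0, x_{C,0})`, and conditionally on the
history up to time `n` the pair at time `n + 1` is distributed according to
`step` from the pair at time `n`. There is at most one such law, see
`ControlStrategy.IsExecutionLaw.unique`. -/
structure IsExecutionLaw (C : ControlStrategy X U) (M : GMDP X U Y)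
    (P : Measure (ℕ → X × C.XC)) : Prop where
  isProbabilityMeasure : IsProbabilityMeasure P
  initial : P.map (fun ω => ω 0) = Measure.dirac (M.x0, C.init)
  transition : ∀ (n : ℕ) (A : Set (Finset.Iic n → X × C.XC)) (B : Set (X × C.XC)),
    MeasurableSet A → MeasurableSet B →
      P {ω | (fun i : Finset.Iic n => ω i) ∈ A ∧ ω (n + 1) ∈ B} =
        ∫⁻ ω in {ω | (fun i : Finset.Iic n => ω i) ∈ A}, C.step M (ω n) B ∂P


lemma universallyMeasurable_step (C : ControlStrategy X U) (M : GMDP X U Y) :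
    UniversallyMeasurable (C.step M) := by
  have h1 : UniversallyMeasurable fun s : X × C.XC => C.trans (s.2, s.1) :=
    C.universallyMeasurable_trans.comp measurable_swap
  have h2 : UniversallyMeasurable fun p : (X × C.XC) × C.XC => C.out p.2 :=
    C.universallyMeasurable_out.comp measurable_snd
  have h3 : UniversallyMeasurable fun p : ((X × C.XC) × C.XC) × U =>
      (M.t (p.1.1.1, p.2)).map fun x' => (x', p.1.2) := by
    intro m _
    refine Measurable.aemeasurable (Measure.measurable_of_measurable_coe _ fun s hs => ?_)
    have hM := M.isMarkov
    let K : Kernel (((X × C.XC) × C.XC) × U) X :=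
      M.t.comap (fun p => (p.1.1.1, p.2)) (by fun_prop)
    have h4 : ∀ p : ((X × C.XC) × C.XC) × U,
        ((M.t (p.1.1.1, p.2)).map fun x' => (x', p.1.2)) s =
          K p (Prod.mk p ⁻¹' {r | (r.2, r.1.1.2) ∈ s}) := fun p => by
      rw [Measure.map_apply (by fun_prop) hs]; rfl
    simp_rw [h4]
    exact Kernel.measurable_kernel_prodMk_left
      (measurableSet_preimage (f := fun r : (((X × C.XC) × C.XC) × U) × X => (r.2, r.1.1.2))
        (by fun_prop) hs)
  have h5 := UniversallyMeasurable.bind h2 h3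
  exact UniversallyMeasurable.bind (f := fun p : (X × C.XC) × C.XC =>
    (C.out p.2 : Measure U).bind fun u => (M.t (p.1.1, u)).map fun x' => (x', p.2)) h1 h5

/-- The law of the execution is uniquely determined. -/
theorem IsExecutionLaw.unique {C : ControlStrategy X U} {M : GMDP X U Y}
    {P P' : Measure (ℕ → X × C.XC)} (h : C.IsExecutionLaw M P) (h' : C.IsExecutionLaw M P') :
    P = P' := by
  have := h.isProbabilityMeasure
  have := h'.isProbabilityMeasure
  have hm : ∀ n : ℕ, Measurable fun (ω : ℕ → X × C.XC) (i : Finset.Iic n) => ω i := fun n => by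
    fun_prop
  have key : ∀ n : ℕ, P.map (fun ω (i : Finset.Iic n) => ω i) =
      P'.map (fun ω (i : Finset.Iic n) => ω i) := by
    intro n
    induction n with
    | zero =>
      let e : (X × C.XC) → (Finset.Iic 0 → X × C.XC) := fun s _ => s
      have he : Measurable e := by fun_prop
      have h0 : (fun (ω : ℕ → X × C.XC) (i : Finset.Iic 0) => ω i) = e ∘ fun ω => ω 0 := by
        funext ω i
        have : (i : ℕ) = 0 := Nat.le_zero.1 (Finset.mem_Iic.1 i.2)
        simp [e, this]
      rw [h0, ← Measure.map_map he (by fun_prop), ← Measure.map_map he (by fun_prop), h.initial,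
        h'.initial]
    | succ n ih =>
      have hpair : Measurable fun ω : ℕ → X × C.XC =>
          ((fun i : Finset.Iic n => ω i), ω (n + 1)) := (hm n).prodMk (by fun_prop)
      have h1 : P.map (fun ω => ((fun i : Finset.Iic n => ω i), ω (n + 1))) =
          P'.map (fun ω => ((fun i : Finset.Iic n => ω i), ω (n + 1))) := by
        have := Measure.isProbabilityMeasure_map (μ := P) hpair.aemeasurable
        refine Measure.ext_prod fun {A B} hA hB => ?_
        rw [Measure.map_apply hpair (hA.prod hB), Measure.map_apply hpair (hA.prod hB)]
        have aux : ∀ Q : Measure (ℕ → X × C.XC), C.IsExecutionLaw M Q →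
            Q ((fun ω => ((fun i : Finset.Iic n => ω i), ω (n + 1))) ⁻¹' A ×ˢ B) =
              ∫⁻ w in A, C.step M (w ⟨n, by simp⟩) B
                ∂(Q.map (fun ω (i : Finset.Iic n) => ω i)) := by
          intro Q hQ
          have := hQ.isProbabilityMeasure
          have := Measure.isProbabilityMeasure_map (μ := Q) (hm n).aemeasurable
          refine (hQ.transition n A B hA hB).trans ?_
          have hs : UniversallyMeasurable fun w : Finset.Iic n → X × C.XC =>
              C.step M (w ⟨n, by simp⟩) :=
            (C.universallyMeasurable_step M).comp (measurable_pi_apply _)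
          have ha := ((Measure.measurable_coe hB).comp_aemeasurable
            (hs (Q.map fun ω (i : Finset.Iic n) => ω i) inferInstance)).restrict (s := A)
          rw [Measure.restrict_map (hm n) hA] at ha ⊢
          exact (lintegral_map' ha (hm n).aemeasurable).symm
        rw [aux P h, aux P' h', ih]
      let e : (Finset.Iic n → X × C.XC) × (X × C.XC) → (Finset.Iic (n + 1) → X × C.XC) :=
        fun p i => if hi : (i : ℕ) ≤ n then p.1 ⟨i, by simpa using hi⟩ else p.2
      have he : Measurable e := by
        refine measurable_pi_lambda _ fun i => ?_
        by_cases hi : (i : ℕ) ≤ n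
        · simp only [e, hi, dite_true]; fun_prop
        · simp only [e, hi, dite_false]; fun_prop
      have h0 : (fun (ω : ℕ → X × C.XC) (i : Finset.Iic (n + 1)) => ω i) =
          e ∘ fun ω => ((fun i : Finset.Iic n => ω i), ω (n + 1)) := by
        funext ω i
        by_cases hi : (i : ℕ) ≤ n
        · simp [e, hi]
        · have h2 : (i : ℕ) ≤ n + 1 := Finset.mem_Iic.1 i.2
          have h3 : (i : ℕ) = n + 1 := by omega
          simp [e, h3]
      rw [h0, ← Measure.map_map he hpair, ← Measure.map_map he hpair, h1]
  have hproj : ∀ Q : Measure (ℕ → X × C.XC), IsProbabilityMeasure Q →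
      (∀ n : ℕ, Q.map (fun ω (i : Finset.Iic n) => ω i) =
        P'.map (fun ω (i : Finset.Iic n) => ω i)) →
      IsProjectiveLimit Q fun I : Finset ℕ => P'.map I.restrict := by
    intro Q _ hQ I
    obtain ⟨n, hn⟩ : ∃ n, I ⊆ Finset.Iic n :=
      ⟨I.sup id, fun i hi => Finset.mem_Iic.2 (Finset.le_sup (f := id) hi)⟩
    have h0 : ∀ Q : Measure (ℕ → X × C.XC), Q.map (Finset.restrict (π := fun _ => X × C.XC) I) =
        (Q.map (fun ω (i : Finset.Iic n) => ω i)).map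
          (Finset.restrict₂ (π := fun _ => X × C.XC) hn) := fun Q =>
      (Measure.map_map (f := fun (ω : ℕ → X × C.XC) (i : Finset.Iic n) => ω i)
        (g := Finset.restrict₂ (π := fun _ => X × C.XC) hn)
        (Finset.measurable_restrict₂ (X := fun _ => X × C.XC) hn) (hm n)).symm
    change Q.map (Finset.restrict (π := fun _ => X × C.XC) I) =
      P'.map (Finset.restrict (π := fun _ => X × C.XC) I)
    rw [h0 Q, h0 P', hQ n]
  have hfin : ∀ I : Finset ℕ, IsFiniteMeasure (P'.map I.restrict) := fun I => inferInstance
  exact (hproj P inferInstance key).unique (hproj P' inferInstance fun _ => rfl)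

end ControlStrategy

/-! ### scLTL and automata -/

/-- Syntactically co-safe LTL formulas over the atomic propositions `AP`. -/
inductive ScLTL (AP : Type*) where
  | atom : AP → ScLTL AP
  | negAtom : AP → ScLTL AP
  | and : ScLTL AP → ScLTL AP → ScLTL AP
  | or : ScLTL AP → ScLTL AP → ScLTL AP
  | next : ScLTL AP → ScLTL AP
  | until : ScLTL AP → ScLTL AP → ScLTL AP

/-- `SatAt w ψ t` is `w_t ⊨ ψ`: the suffix at time `t` of the word `w` over `2^AP` satisfies `ψ`. -/
def ScLTL.SatAt {AP : Type*} (w : ℕ → Set AP) : ScLTL AP → ℕ → Prop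
  | .atom p, t => p ∈ w t
  | .negAtom p, t => p ∉ w t
  | .and ψ₁ ψ₂, t => ψ₁.SatAt w t ∧ ψ₂.SatAt w t
  | .or ψ₁ ψ₂, t => ψ₁.SatAt w t ∨ ψ₂.SatAt w t
  | .next ψ, t => ψ.SatAt w (t + 1)
  | .until ψ₁ ψ₂, t => ∃ i, ψ₂.SatAt w (t + i) ∧ ∀ j < i, ψ₁.SatAt w (t + j)

/-- `w ⊨ ψ` -/
def ScLTL.Sat {AP : Type*} (w : ℕ → Set AP) (ψ : ScLTL AP) : Prop := ψ.SatAt w 0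

/-- The infinite word `w` is accepted by the automaton: some finite run on a prefix of `w` ends in
an accepting location. -/
def DFA.AcceptsWord {S Q : Type*} (A : DFA S Q) (w : ℕ → S) : Prop :=
  ∃ (n : ℕ) (r : ℕ → Q), r 0 = A.start ∧ (∀ i < n, r (i + 1) = A.step (r i) (w i)) ∧
    r n ∈ A.accept

/-- `A` is an automaton `A_ψ` for `ψ`: its accepted words are exactly the words satisfying `ψ`. -/
def DFA.Recognizes {AP Q : Type*} (A : DFA (Set AP) Q) (ψ : ScLTL AP) : Prop :=
  ∀ w : ℕ → Set AP, ψ.Sat w ↔ A.AcceptsWord w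

/-- A labelling function with values in the finite alphabet `2^AP` is measurable if its level sets
are. -/
def MeasurableLabelling {Y AP : Type*} [MeasurableSpace Y] (L : Y → Set AP) : Prop :=
  ∀ a : Set AP, MeasurableSet (L ⁻¹' {a})

lemma measurable_dfa_step {X Y AP Q : Type*} [MeasurableSpace X] [MeasurableSpace Y] [Finite AP]
    [Finite Q] [MeasurableSpace Q] [DiscreteMeasurableSpace Q] (A : DFA (Set AP) Q)
    {L : Y → Set AP} (hL : MeasurableLabelling L) {h : X → Y} (hh : Measurable h) :
    Measurable fun p : X × Q => (p.1, A.step p.2 (L (h p.1))) := by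
  refine measurable_fst.prodMk (measurable_from_prod_countable_left fun q => ?_)
  refine measurable_to_countable' fun q' => ?_
  have : (fun x => A.step q (L (h x))) ⁻¹' {q'} =
      ⋃ a ∈ {a : Set AP | A.step q a = q'}, h ⁻¹' (L ⁻¹' {a}) := by
    ext x; simp
  change MeasurableSet ((fun x => A.step q (L (h x))) ⁻¹' {q'})
  rw [this]
  exact (Set.toFinite _).measurableSet_biUnion fun a _ => hh (hL a)

namespace GMDP

variable {X U Y AP Q : Type*} [MeasurableSpace X] [MeasurableSpace U] [MeasurableSpace Y]
  [Finite AP] [Finite Q] [MeasurableSpace Q] [DiscreteMeasurableSpace Q]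

/-- The product gMDP `M ⊗ A`: from `(x, q)` under `u`, the state moves to `x' ∼ t(· | x, u)` and the
location to `τ(q, L(h(x')))`. -/
noncomputable def product (M : GMDP X U Y) (A : DFA (Set AP) Q) (L : Y → Set AP)
    (hL : MeasurableLabelling L) : GMDP (X × Q) U Y where
  x0 := (M.x0, A.step A.start (L (M.h M.x0)))
  t := ((M.t.comap (fun p : (X × Q) × U => (p.1.1, p.2)) (by fun_prop)) ×ₖ
      Kernel.deterministic (fun p : (X × Q) × U => p.1.2) (by fun_prop)).map
    fun p : X × Q => (p.1, A.step p.2 (L (M.h p.1)))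
  isMarkov := by
    have := M.isMarkov
    exact Kernel.IsMarkovKernel.map _ (measurable_dfa_step A hL M.measurable_h)
  h := fun p => M.h p.1
  measurable_h := M.measurable_h.comp measurable_fst

lemma product_t_apply (M : GMDP X U Y) (A : DFA (Set AP) Q) (L : Y → Set AP)
    (hL : MeasurableLabelling L) (x : X) (q : Q) (u : U) :
    (M.product A L hL).t ((x, q), u) =
      (M.t (x, u)).map fun x' => (x', A.step q (L (M.h x'))) := by
  have := M.isMarkov
  have hm := measurable_dfa_step A hL M.measurable_h
  simp only [product]
  rw [Kernel.map_apply _ hm, Kernel.prod_apply, Kernel.comap_apply, Kernel.deterministic_apply,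
    Measure.prod_dirac, Measure.map_map hm (by fun_prop)]
  rfl

end GMDP

/-- A stationary Markov policy `(μ, μ, …)` on a gMDP, given by the universally measurable map `μ`
from states to probability measures on the inputs. -/
structure StationaryPolicy {X U Y : Type*} [MeasurableSpace X] [MeasurableSpace U]
    [MeasurableSpace Y] (M : GMDP X U Y) where
  toFun : X → ProbabilityMeasure U
  universallyMeasurable_toFun : UniversallyMeasurable toFun

/-! ### The `(ε, δ)`-robust operator and robust satisfaction probability -/

section Robust

variable {X U Y AP Q : Type*} [MeasurableSpace X] [MeasurableSpace U] [MetricSpace Y]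
  [MeasurableSpace Y]

/-- `τ̄(q, x̂) = {τ(q, α) : α ∈ L(N_ε(ĥ(x̂)))}` -/
def ambiguousSucc (M : GMDP X U Y) (A : DFA (Set AP) Q) (L : Y → Set AP) (ε : ℝ≥0)
    (q : Q) (x : X) : Set Q :=
  (fun a => A.step q a) '' (L '' {y | dist y (M.h x) ≤ ε})

/-- `max {1_F(q), v}` -/
noncomputable def maxAccept {S : Type*} (A : DFA S Q) (q : Q) (v : ℝ≥0∞) : ℝ≥0∞ :=
  max (A.accept.indicator 1 q) v

/-- The `(ε, δ)`-robust operator, acting on `[0, ∞]`-valued functions: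
`T(V)(x̂, q) = L(∫ min_{q' ∈ τ̄(q, x̂')} max {1_F(q'), V(x̂', q')} t(dx̂' | x̂, μ(x̂, q)) - δ)`,
where `L` is the truncation to `[0, 1]`. The minimum is over a finite nonempty set, and the
subtraction of `ℝ≥0∞` is already truncated at `0`. -/
noncomputable def robustOp (M : GMDP X U Y) (A : DFA (Set AP) Q) (L : Y → Set AP) (ε δ : ℝ≥0)
    (μ : X × Q → ProbabilityMeasure U) (V : X × Q → ℝ≥0∞) : X × Q → ℝ≥0∞ := fun s =>
  min 1 ((∫⁻ x', ⨅ q' ∈ ambiguousSucc M A L ε s.2 x', maxAccept A q' (V (x', q'))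
    ∂(M.next s.1 (μ s))) - δ)

/-- `V_∞ = lim_l T^l(0)`, the limit of an increasing sequence (see `tendsto_robustOp_iterate`). -/
noncomputable def robustValue (M : GMDP X U Y) (A : DFA (Set AP) Q) (L : Y → Set AP) (ε δ : ℝ≥0)
    (μ : X × Q → ProbabilityMeasure U) : X × Q → ℝ≥0∞ := fun s =>
  ⨆ l : ℕ, (robustOp M A L ε δ μ)^[l] 0 s

lemma robustOp_mono (M : GMDP X U Y) (A : DFA (Set AP) Q) (L : Y → Set AP) (ε δ : ℝ≥0)
    (μ : X × Q → ProbabilityMeasure U) : Monotone (robustOp M A L ε δ μ) := by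
  intro V W hVW s
  refine min_le_min le_rfl (tsub_le_tsub_right (lintegral_mono fun x' => ?_) _)
  exact iInf₂_mono fun q' _ => max_le_max le_rfl (hVW _)

lemma tendsto_robustOp_iterate (M : GMDP X U Y) (A : DFA (Set AP) Q) (L : Y → Set AP)
    (ε δ : ℝ≥0) (μ : X × Q → ProbabilityMeasure U) (s : X × Q) :
    Tendsto (fun l : ℕ => (robustOp M A L ε δ μ)^[l] 0 s) atTop
      (𝓝 (robustValue M A L ε δ μ s)) := by
  have hmono : Monotone fun l : ℕ => (robustOp M A L ε δ μ)^[l] 0 :=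
    (robustOp_mono M A L ε δ μ).monotone_iterate_of_le_map bot_le
  exact tendsto_atTop_iSup fun _ _ hl => hmono hl s

/-- The `(ε, δ)`-robust satisfaction probability
`S = min_{q̄₀ ∈ τ̄(q₀, x̂₀)} max {1_F(q̄₀), V_∞(x̂₀, q̄₀)}`. -/
noncomputable def robustSatProb (M : GMDP X U Y) (A : DFA (Set AP) Q) (L : Y → Set AP)
    (ε δ : ℝ≥0) (μ : X × Q → ProbabilityMeasure U) : ℝ≥0∞ :=
  ⨅ q' ∈ ambiguousSucc M A L ε A.start M.x0, maxAccept A q' (robustValue M A L ε δ μ (M.x0, q'))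

end Robust

/-! ### Approximate simulation -/

/-- `W` is a lifting showing that `(Δ, Θ)` belongs to the `δ`-lifted relation of `R`. -/
structure IsLifting {X' X : Type*} [MeasurableSpace X'] [MeasurableSpace X] (R : Set (X' × X))
    (δ : ℝ≥0) (Δ : Measure X') (Θ : Measure X) (W : Measure (X' × X)) : Prop where
  isProbabilityMeasure : IsProbabilityMeasure W
  fst : ∀ S, MeasurableSet S → W (S ×ˢ Set.univ) = Δ S
  snd : ∀ S, MeasurableSet S → W (Set.univ ×ˢ S) = Θ S
  one_sub_le : 1 - (δ : ℝ≥0∞) ≤ W R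

/-- `M' ⪯ M`: the gMDP `M'` is `(ε, δ)`-stochastically simulated by `M`, through an interface
function `Uv`, a measurable relation `R` and a Borel measurable stochastic kernel `W`. -/
def StochasticallySimulatedBy {X' U' X U Y : Type*} [MeasurableSpace X'] [MeasurableSpace U']
    [MeasurableSpace X] [MeasurableSpace U] [MetricSpace Y] [MeasurableSpace Y] (ε δ : ℝ≥0)
    (M' : GMDP X' U' Y) (M : GMDP X U Y) : Prop :=
  ∃ (Uv : U' × X' × X → ProbabilityMeasure U) (R : Set (X' × X))
    (W : Kernel (U' × X' × X) (X' × X)),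
    UniversallyMeasurable Uv ∧ MeasurableSet R ∧ IsMarkovKernel W ∧
    (M'.x0, M.x0) ∈ R ∧
    ∀ (x' : X') (x : X), (x', x) ∈ R →
      dist (M'.h x') (M.h x) ≤ ε ∧
      ∀ u' : U', IsLifting R δ (M'.t (x', u')) (M.next x (Uv (u', x', x))) (W (u', x', x))

/-! ### Universally measurable kernels -/

section UniversallyMeasurable

variable {α β γ : Type*} [MeasurableSpace α] [MeasurableSpace β] [MeasurableSpace γ]

/-! The controller runs a copy of the abstract process next to the concrete one. Given the stored
triple `v = (u', x', x)` and the concrete state `y` just observed, it draws the new abstract state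
from the conditional law `κ(· | v, y)` obtained by disintegrating `W(v)`. While the stored pair lies
in `R`, the pair of new states then has law `W(v)`. So the abstract coordinate moves as in the
abstract model, the concrete one as in the concrete model under the interface, and the pair stays in
`R` up to mass `δ`. The automaton location in memory is driven by the true concrete labels, and the
abstract input is drawn from `μ` at the abstract state and this location.

The core is `robustOp_iterate_le_expectNext`: on `R`, the `l`-th iterate of the robust operator is
at most the expected value, one step later, of the probability of reaching acceptance within `l`
further steps. Each induction step pays `δ` once, for leaving `R` (`IsLifting.lintegral_le`). On `R`
the outputs are `ε`-close, so the true next location is a candidate in the minimum. Off `R` the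
bound claims nothing.

The rest is probability: an execution law exists although the kernels are only universally
measurable (`exists_chainLaw`), the backward recursion for hitting probabilities bounds the path
probability from below (`hitProb_le_measure`), and the stored location is almost surely the
automaton run on the label word. -/

lemma Measurable.universallyMeasurable {f : α → β} (hf : Measurable f) :
    UniversallyMeasurable f := fun _ _ => hf.aemeasurable

lemma UniversallyMeasurable.toProbabilityMeasure {κ : α → Measure β}
    (hκ : UniversallyMeasurable κ) (hp : ∀ a, IsProbabilityMeasure (κ a)) :
    UniversallyMeasurable fun a => (⟨κ a, hp a⟩ : ProbabilityMeasure β) := fun m hm =>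
  AEMeasurable.subtype_mk (hκ m hm)

lemma isProbabilityMeasure_bind_of_aemeasurable {m : Measure α} [IsProbabilityMeasure m]
    {κ : α → Measure β} (hκ : AEMeasurable κ m) (hp : ∀ a, IsProbabilityMeasure (κ a)) :
    IsProbabilityMeasure (m.bind κ) :=
  ⟨by simp [Measure.bind_apply MeasurableSet.univ hκ]⟩

lemma UniversallyMeasurable.bind_measure {κ : α → Measure β} (hκ : UniversallyMeasurable κ)
    (hp : ∀ a, IsProbabilityMeasure (κ a)) {f : α × β → Measure γ}
    (hf : UniversallyMeasurable f) :
    UniversallyMeasurable fun a => (κ a).bind fun b => f (a, b) :=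
  UniversallyMeasurable.bind (hκ.toProbabilityMeasure hp) hf

/-- The mixture `m.bind κ` is the measure at which to test `f`: a measurable version of `f` agrees
with it `κ a`-almost everywhere for `m`-almost every `a`. -/
lemma UniversallyMeasurable.lintegral {κ : α → Measure β} (hκ : UniversallyMeasurable κ)
    (hp : ∀ a, IsProbabilityMeasure (κ a)) {f : β → ℝ≥0∞} (hf : UniversallyMeasurable f) :
    UniversallyMeasurable fun a => ∫⁻ b, f b ∂κ a := fun m hm =>
  (Measure.aemeasurable_lintegral
    (hf (m.bind κ) (isProbabilityMeasure_bind_of_aemeasurable (hκ m hm) hp))).comp_aemeasurable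
    (hκ m hm)

lemma UniversallyMeasurable.lintegral_bind {m : Measure α} [IsProbabilityMeasure m]
    {κ : α → Measure β} (hκ : UniversallyMeasurable κ) (hp : ∀ a, IsProbabilityMeasure (κ a))
    {f : β → ℝ≥0∞} (hf : UniversallyMeasurable f) :
    ∫⁻ b, f b ∂m.bind κ = ∫⁻ a, ∫⁻ b, f b ∂κ a ∂m :=
  Measure.lintegral_bind (hκ m inferInstance)
    (hf _ (isProbabilityMeasure_bind_of_aemeasurable (hκ m inferInstance) hp))

/-- A universally measurable stochastic kernel agrees almost everywhere with a Markov kernel. -/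
lemma UniversallyMeasurable.exists_kernel_ae_eq {κ : α → Measure β}
    (hκ : UniversallyMeasurable κ) (hp : ∀ a, IsProbabilityMeasure (κ a)) (m : Measure α)
    [IsProbabilityMeasure m] :
    ∃ K : Kernel α β, IsMarkovKernel K ∧ ∀ᵐ a ∂m, κ a = K a := by
  obtain ⟨g, hg, hκg⟩ := hκ.toProbabilityMeasure hp m inferInstance
  refine ⟨⟨fun a => (g a : Measure β), measurable_subtype_coe.comp hg⟩,
    ⟨fun a => (g a).2⟩, ?_⟩
  filter_upwards [hκg] with a ha
  exact congrArg Subtype.val ha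

end UniversallyMeasurable

/-! ### Markov chains with a universally measurable transition kernel -/

section MarkovChain

variable {S : Type*} [MeasurableSpace S]

/-- The law at time `n` of the chain with transition kernel `κ` started in `s₀`. -/
noncomputable def chainMarginal (κ : S → Measure S) (s₀ : S) : ℕ → Measure S
  | 0 => Measure.dirac s₀
  | n + 1 => (chainMarginal κ s₀ n).bind κ

lemma isProbabilityMeasure_chainMarginal {κ : S → Measure S} (hκ : UniversallyMeasurable κ)
    (hp : ∀ s, IsProbabilityMeasure (κ s)) (s₀ : S) (n : ℕ) :
    IsProbabilityMeasure (chainMarginal κ s₀ n) := by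
  induction n with
  | zero => exact inferInstanceAs (IsProbabilityMeasure (Measure.dirac s₀))
  | succ n ih => exact isProbabilityMeasure_bind_of_aemeasurable (hκ _ ih) hp

/-- Ionescu-Tulcea theorem for a universally measurable transition kernel. -/
theorem exists_chainLaw {κ : S → Measure S} (hκ : UniversallyMeasurable κ)
    (hp : ∀ s, IsProbabilityMeasure (κ s)) (s₀ : S) :
    ∃ P : Measure (ℕ → S), IsProbabilityMeasure P ∧
      P.map (fun ω => ω 0) = Measure.dirac s₀ ∧
      ∀ (n : ℕ) (A : Set (Finset.Iic n → S)) (B : Set S), MeasurableSet A → MeasurableSet B →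
        P {ω | (fun i : Finset.Iic n => ω i) ∈ A ∧ ω (n + 1) ∈ B} =
          ∫⁻ ω in {ω | (fun i : Finset.Iic n => ω i) ∈ A}, κ (ω n) B ∂P := by
  have hm := isProbabilityMeasure_chainMarginal hκ hp s₀
  -- The measurable version depends on the time, since the exceptional null set does. The marginals
  -- come from `κ` itself, so they are available before any path measure exists.
  choose K hK hKκ using fun n => hκ.exists_kernel_ae_eq hp (chainMarginal κ s₀ n)
  let last : ∀ n : ℕ, (Finset.Iic n → S) → S := fun n w => w ⟨n, by simp⟩
  have hlast : ∀ n, Measurable (last n) := fun n => measurable_pi_apply _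
  let η : (n : ℕ) → Kernel (Finset.Iic n → S) S := fun n => (K n).comap (last n) (hlast n)
  have hη : ∀ n, IsMarkovKernel (η n) := fun n => inferInstance
  let P : Measure (ℕ → S) := Kernel.trajMeasure (X := fun _ => S) (Measure.dirac s₀) η
  have hP : IsProbabilityMeasure P := inferInstance
  have htr : ∀ (n : ℕ) (A : Set (Finset.Iic n → S)) (B : Set S), MeasurableSet A →
      MeasurableSet B → P {ω | (fun i : Finset.Iic n => ω i) ∈ A ∧ ω (n + 1) ∈ B} =
        ∫⁻ ω in {ω | (fun i : Finset.Iic n => ω i) ∈ A}, K n (ω n) B ∂P := by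
    intro n A B hA hB
    have h1 := Kernel.map_frestrictLe_trajMeasure_compProd_eq_map_trajMeasure
      (X := fun _ => S) (μ₀ := Measure.dirac s₀) (κ := η) (a := n)
    have h2 := congrArg (fun m => m (A ×ˢ B)) h1
    rw [Measure.compProd_apply_prod hA hB, Measure.map_apply (by fun_prop) (hA.prod hB),
      setLIntegral_map hA ((η n).measurable_coe hB) (by fun_prop)] at h2
    exact h2.symm
  have h0 : P.map (fun ω => ω 0) = Measure.dirac s₀ := by
    have h1 : P.map (Preorder.frestrictLe (π := fun _ => S) 0) =
        (Measure.dirac s₀).map (MeasurableEquiv.piUnique (fun _ : Finset.Iic 0 => S)).symm := by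
      change (Kernel.traj (X := fun _ => S) η 0 ∘ₘ _).map _ = _
      rw [Measure.map_comp _ _ (by fun_prop), Kernel.traj_map_frestrictLe,
        Kernel.partialTraj_self, Measure.id_comp]
    have h2 := congrArg (Measure.map (last 0)) h1
    rw [Measure.map_map (hlast 0) (by fun_prop), Measure.map_map (hlast 0) (by fun_prop),
      Measure.map_dirac' (by fun_prop)] at h2
    exact h2
  -- This closes the loop: `P` is built from the versions `K n` but has the marginals of `κ`, so `K
  -- n` and `κ` agree almost surely at the state visited at time `n`.
  have hmarg : ∀ n, P.map (fun ω => ω n) = chainMarginal κ s₀ n := by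
    intro n
    induction n with
    | zero => exact h0
    | succ n ih =>
      refine Measure.ext fun B hB => ?_
      have h1 := htr n Set.univ B MeasurableSet.univ hB
      simp only [Set.mem_univ, true_and, Set.ofPred_true, Measure.restrict_univ] at h1
      rw [Measure.map_apply (by fun_prop) hB]
      refine h1.trans ?_
      rw [chainMarginal, Measure.bind_apply hB (hκ _ (hm n)),
        lintegral_congr_ae ((hKκ n).mono fun s hs => congrArg (fun m => m B) hs), ← ih,
        lintegral_map ((K n).measurable_coe hB) (measurable_pi_apply n)]
  refine ⟨P, hP, h0, fun n A B hA hB => (htr n A B hA hB).trans ?_⟩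
  refine lintegral_congr_ae (ae_restrict_of_ae ?_)
  have h1 := hKκ n
  rw [← hmarg n] at h1
  filter_upwards [ae_of_ae_map (measurable_pi_apply n).aemeasurable h1] with ω hω
  rw [hω]

/-- The probability that the chain with transition kernel `κ` hits `acc` within `l` steps. -/
noncomputable def hitProb (κ : S → Measure S) (acc : Set S) : ℕ → S → ℝ≥0∞
  | 0 => acc.indicator 1
  | l + 1 => fun s => max (acc.indicator 1 s) (∫⁻ s', hitProb κ acc l s' ∂κ s)

lemma universallyMeasurable_hitProb {κ : S → Measure S} (hκ : UniversallyMeasurable κ)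
    (hp : ∀ s, IsProbabilityMeasure (κ s)) {acc : Set S} (hacc : MeasurableSet acc) (l : ℕ) :
    UniversallyMeasurable (hitProb κ acc l) := by
  have h1 : Measurable (acc.indicator (1 : S → ℝ≥0∞)) := measurable_one.indicator hacc
  induction l with
  | zero => exact h1.universallyMeasurable
  | succ l ih => exact fun m hm => h1.aemeasurable.max (hκ.lintegral hp ih m hm)

lemma hitProb_of_mem {κ : S → Measure S} {acc : Set S} {s : S} (hs : s ∈ acc) (l : ℕ) :
    1 ≤ hitProb κ acc l s := by
  cases l <;> simp [hitProb, hs]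

lemma hitProb_le_one {κ : S → Measure S} (hp : ∀ s, IsProbabilityMeasure (κ s)) {acc : Set S}
    (l : ℕ) (s : S) : hitProb κ acc l s ≤ 1 := by
  have h1 : ∀ s, acc.indicator (1 : S → ℝ≥0∞) s ≤ 1 := Set.indicator_le_self _ _
  induction l generalizing s with
  | zero => exact h1 s
  | succ l ih => exact max_le (h1 s) ((lintegral_mono ih).trans (by simp))

/-- The Markov property turns the backward recursion into a forward statement about paths. Only the
lower bound is needed, for each fixed horizon. -/
theorem hitProb_le_measure [MeasurableSingletonClass S] {κ : S → Measure S}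
    (hκ : UniversallyMeasurable κ)
    (hp : ∀ s, IsProbabilityMeasure (κ s)) {P : Measure (ℕ → S)} [IsProbabilityMeasure P]
    (hP : ∀ (n : ℕ) (A : Set (Finset.Iic n → S)) (B : Set S), MeasurableSet A → MeasurableSet B →
        P {ω | (fun i : Finset.Iic n => ω i) ∈ A ∧ ω (n + 1) ∈ B} =
          ∫⁻ ω in {ω | (fun i : Finset.Iic n => ω i) ∈ A}, κ (ω n) B ∂P)
    {s₀ : S} (h0 : P.map (fun ω => ω 0) = Measure.dirac s₀) {acc : Set S}
    (hacc : MeasurableSet acc) (l : ℕ) : hitProb κ acc l s₀ ≤ P {ω | ∃ k, ω k ∈ acc} := by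
  have hr : ∀ n : ℕ, Measurable fun (ω : ℕ → S) (i : Finset.Iic n) => ω i := fun n => by
    fun_prop
  have hev : ∀ n : ℕ, Measurable fun ω : ℕ → S => ω n := measurable_pi_apply
  have hκn : ∀ n : ℕ, AEMeasurable (fun ω : ℕ → S => κ (ω n)) P := fun n =>
    hκ.comp (hev n) P inferInstance
  have hG := universallyMeasurable_hitProb hκ hp hacc
  -- The one-step identity as an equality of measures, which makes it usable for integrals of
  -- universally measurable functions.
  have hbind : ∀ (n : ℕ) (A : Set (Finset.Iic n → S)), MeasurableSet A →
      (P.restrict {ω | (fun i : Finset.Iic n => ω i) ∈ A}).map (fun ω => ω (n + 1)) =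
        (P.restrict {ω | (fun i : Finset.Iic n => ω i) ∈ A}).bind fun ω => κ (ω n) := by
    intro n A hA
    refine Measure.ext fun B hB => ?_
    have hB' : MeasurableSet ((fun ω : ℕ → S => ω (n + 1)) ⁻¹' B) :=
      measurableSet_preimage (by fun_prop) hB
    rw [Measure.map_apply (by fun_prop) hB, Measure.restrict_apply hB', Measure.bind_apply hB
      (hκn n).restrict, ← hP n A B hA hB,
      Set.inter_comm]
    rfl
  -- Strengthened to arbitrary times and history events: the induction on the horizon moves to time
  -- `n + 1` and must remember that `acc` was not hit at time `n`.
  have hmain : ∀ (l n : ℕ) (A : Set (Finset.Iic n → S)), MeasurableSet A →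
      ∫⁻ ω in {ω | (fun i : Finset.Iic n => ω i) ∈ A}, hitProb κ acc l (ω n) ∂P ≤
        P ({ω | (fun i : Finset.Iic n => ω i) ∈ A} ∩ {ω | ∃ k ≥ n, ω k ∈ acc}) := by
    intro l
    induction l with
    | zero =>
      intro n A hA
      have hn : MeasurableSet {ω : ℕ → S | ω n ∈ acc} :=
        measurableSet_preimage (f := fun ω : ℕ → S => ω n) (by fun_prop) hacc
      have h1 : (fun ω : ℕ → S => hitProb κ acc 0 (ω n)) = {ω | ω n ∈ acc}.indicator 1 := rfl
      rw [h1, lintegral_indicator_one hn, Measure.restrict_apply hn, Set.inter_comm]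
      exact measure_mono (Set.inter_subset_inter_right _ fun ω hω => ⟨n, le_rfl, hω⟩)
    | succ l ih =>
      intro n A hA
      let i₀ : Finset.Iic n := ⟨n, by simp⟩
      let D : Set (Finset.Iic n → S) := {w | w i₀ ∈ acc}
      have hD : MeasurableSet D :=
        measurableSet_preimage (f := fun w : Finset.Iic n → S => w i₀) (by fun_prop) hacc
      let ρ : (Finset.Iic (n + 1) → S) → Finset.Iic n → S :=
        fun w i => w ⟨i, Finset.mem_Iic.2 ((Finset.mem_Iic.1 i.2).trans n.le_succ)⟩
      have hρ : Measurable ρ := by fun_prop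
      have hset : ∀ B : Set (Finset.Iic n → S), MeasurableSet B →
          MeasurableSet {ω : ℕ → S | (fun i : Finset.Iic n => ω i) ∈ B} := fun B hB =>
        measurableSet_preimage (hr n) hB
      have hsplit : {ω : ℕ → S | (fun i : Finset.Iic n => ω i) ∈ A} =
          {ω | (fun i : Finset.Iic n => ω i) ∈ A ∩ D} ∪
            {ω | (fun i : Finset.Iic n => ω i) ∈ A \ D} := by
        ext ω; simp only [Set.mem_ofPred_eq, Set.mem_union, Set.mem_inter_iff, Set.mem_sdiff]; tauto
      have h1 : ∫⁻ ω in {ω | (fun i : Finset.Iic n => ω i) ∈ A ∩ D},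
          hitProb κ acc (l + 1) (ω n) ∂P ≤ P {ω | (fun i : Finset.Iic n => ω i) ∈ A ∩ D} :=
        (lintegral_mono fun ω => hitProb_le_one hp _ _).trans (by simp)
      have h2 : ∫⁻ ω in {ω | (fun i : Finset.Iic n => ω i) ∈ A \ D},
          hitProb κ acc (l + 1) (ω n) ∂P ≤
            P ({ω | (fun i : Finset.Iic n => ω i) ∈ A \ D} ∩ {ω | ∃ k ≥ n + 1, ω k ∈ acc}) := by
        -- `ρ` forgets the last coordinate, so this is the same event seen as a history up to time
        -- `n + 1`.
        have h3 := ih (n + 1) (ρ ⁻¹' (A \ D)) (hρ (hA.diff hD))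
        refine le_trans (le_of_eq ?_) h3
        change _ = ∫⁻ ω in {ω | (fun i : Finset.Iic n => ω i) ∈ A \ D},
          hitProb κ acc l (ω (n + 1)) ∂P
        have hae : AEMeasurable (hitProb κ acc l)
            ((P.restrict {ω | (fun i : Finset.Iic n => ω i) ∈ A \ D}).map
              fun ω => ω (n + 1)) :=
          (hG l (P.map fun ω => ω (n + 1)) (Measure.isProbabilityMeasure_map
            (hev _).aemeasurable)).mono_measure
            (Measure.map_mono Measure.restrict_le_self (hev _))
        rw [← lintegral_map' hae (hev _).aemeasurable]
        rw [hbind n _ (hA.diff hD)] at hae ⊢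
        rw [Measure.lintegral_bind (hκn n).restrict hae]
        refine setLIntegral_congr_fun (hset _ (hA.diff hD)) fun ω hω => ?_
        have h4 : ω n ∉ acc := hω.2
        simp [hitProb, h4]
      rw [hsplit, lintegral_union (hset _ (hA.diff hD))
        (Set.disjoint_left.2 fun ω h h' => h'.2 h.2)]
      refine (add_le_add h1 h2).trans ?_
      have hd : Disjoint {ω : ℕ → S | (fun i : Finset.Iic n => ω i) ∈ A ∩ D}
          ({ω | (fun i : Finset.Iic n => ω i) ∈ A \ D} ∩ {ω | ∃ k ≥ n + 1, ω k ∈ acc}) :=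
        Set.disjoint_left.2 fun ω h h' => h'.1.2 h.2
      rw [← measure_union' hd (hset _ (hA.inter hD))]
      refine measure_mono ?_
      rintro ω (h | ⟨h, k, hk, hk'⟩)
      · exact ⟨Or.inl h, n, le_rfl, h.2⟩
      · exact ⟨Or.inr h, k, by omega, hk'⟩
  have h1 := hmain l 0 Set.univ MeasurableSet.univ
  simp only [Set.mem_univ, Set.ofPred_true, Measure.restrict_univ, Set.univ_inter, ge_iff_le,
    zero_le, true_and] at h1
  refine le_trans (le_of_eq ?_) h1
  have h2 : AEMeasurable (hitProb κ acc l) (P.map fun ω => ω 0) :=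
    hG l _ (Measure.isProbabilityMeasure_map (hev 0).aemeasurable)
  rw [← lintegral_map' h2 (hev 0).aemeasurable, h0, lintegral_dirac]

end MarkovChain

/-! ### The refined controller -/

/-- Memory of the refined controller: a flag telling whether a step has been taken, the last
abstract input, the last abstract state, the last concrete state, and the automaton location. -/
abbrev RefinedMemory (X' U' X Q : Type*) := Bool × (U' × X' × X) × Q

section Refinement

variable {X' U' X U Y Q : Type*} [MeasurableSpace X'] [MeasurableSpace U'] [MeasurableSpace X]
  [MeasurableSpace U] [MeasurableSpace Y] [MeasurableSpace Q]

open Classical in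
/-- The conditional law of the abstract state given the memory and the concrete state: initially
the state `x₀'`, and later on the conditional law `κ`. -/
noncomputable def abstractStateKernel (κ : Kernel ((U' × X' × X) × X) X') (x₀' : X') :
    Kernel (RefinedMemory X' U' X Q × X) X' :=
  Kernel.piecewise (s := (fun p => p.1.1) ⁻¹' {true})
    (measurableSet_preimage (f := fun p : RefinedMemory X' U' X Q × X => p.1.1) (by fun_prop)
      (measurableSet_singleton true))
    (κ.comap (fun p => (p.1.2.1, p.2)) (by fun_prop)) (Kernel.const _ (Measure.dirac x₀'))

instance (κ : Kernel ((U' × X' × X) × X) X') [IsMarkovKernel κ] (x₀' : X') :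
    IsMarkovKernel (abstractStateKernel (Q := Q) κ x₀') := by
  classical exact inferInstanceAs (IsMarkovKernel (Kernel.piecewise _ _ _))

lemma abstractStateKernel_true (κ : Kernel ((U' × X' × X) × X) X') (x₀' : X')
    (v : U' × X' × X) (q : Q) (x : X) :
    abstractStateKernel κ x₀' ((true, v, q), x) = κ (v, x) := by
  classical
  rw [abstractStateKernel, Kernel.piecewise_apply]
  simp

lemma abstractStateKernel_false (κ : Kernel ((U' × X' × X) × X) X') (x₀' : X')
    (v : U' × X' × X) (q : Q) (x : X) :
    abstractStateKernel κ x₀' ((false, v, q), x) = Measure.dirac x₀' := by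
  classical
  rw [abstractStateKernel, Kernel.piecewise_apply]
  simp

/-- The law of the new memory, given the concrete state, the abstract state and the location. -/
noncomputable def memoryLaw (μ : X' × Q → ProbabilityMeasure U') (z : X × X' × Q) :
    Measure (RefinedMemory X' U' X Q) :=
  (μ z.2 : Measure U').bind fun u' => Measure.dirac (true, (u', z.2.1, z.1), z.2.2)

lemma universallyMeasurable_memoryLaw {μ : X' × Q → ProbabilityMeasure U'}
    (hμ : UniversallyMeasurable μ) :
    UniversallyMeasurable (memoryLaw (X := X) μ) := by
  refine UniversallyMeasurable.bind (κ := fun z : X × X' × Q => μ z.2)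
    (f := fun p => Measure.dirac (true, (p.2, p.1.2.1, p.1.1), p.1.2.2))
    (hμ.comp measurable_snd) (Measurable.universallyMeasurable ?_)
  exact Measure.measurable_dirac.comp (by fun_prop)

instance (μ : X' × Q → ProbabilityMeasure U') (z : X × X' × Q) :
    IsProbabilityMeasure (memoryLaw μ z) :=
  isProbabilityMeasure_bind_of_aemeasurable
    (Measure.measurable_dirac.comp (by fun_prop)).aemeasurable fun _ => inferInstance

/-- Measurable singletons allow integration against a Dirac mass with no measurability of the
integrand, which here is only universally measurable. -/
lemma lintegral_memoryLaw [MeasurableSingletonClass X'] [MeasurableSingletonClass U']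
    [MeasurableSingletonClass X] [MeasurableSingletonClass Q]
    (μ : X' × Q → ProbabilityMeasure U') (z : X × X' × Q)
    {f : RefinedMemory X' U' X Q → ℝ≥0∞} (hf : UniversallyMeasurable f) :
    ∫⁻ c, f c ∂memoryLaw μ z = ∫⁻ u', f (true, (u', z.2.1, z.1), z.2.2) ∂(μ z.2 : Measure U') := by
  have h : Measurable fun u' : U' =>
      Measure.dirac ((true, (u', z.2.1, z.1), z.2.2) : RefinedMemory X' U' X Q) :=
    Measure.measurable_dirac.comp (by fun_prop)
  refine (h.universallyMeasurable.lintegral_bind (fun _ => inferInstance) hf).trans ?_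
  simp [lintegral_dirac]

/-- The transition kernel of the memory of the refined controller. -/
noncomputable def refinedTrans (κ : Kernel ((U' × X' × X) × X) X') (x₀' : X')
    (μ : X' × Q → ProbabilityMeasure U') (σ : X × Q → Q) (p : RefinedMemory X' U' X Q × X) :
    Measure (RefinedMemory X' U' X Q) :=
  (abstractStateKernel κ x₀' p).bind fun x' => memoryLaw μ (p.2, x', σ (p.2, p.1.2.2))

lemma universallyMeasurable_memoryLaw_comp {μ : X' × Q → ProbabilityMeasure U'}
    (hμ : UniversallyMeasurable μ) {σ : X × Q → Q} (hσ : Measurable σ) :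
    UniversallyMeasurable fun p : (RefinedMemory X' U' X Q × X) × X' =>
      memoryLaw μ (p.1.2, p.2, σ (p.1.2, p.1.1.2.2)) :=
  (universallyMeasurable_memoryLaw hμ).comp
    (g := fun p : (RefinedMemory X' U' X Q × X) × X' => (p.1.2, p.2, σ (p.1.2, p.1.1.2.2)))
    (by fun_prop)

lemma universallyMeasurable_refinedTrans (κ : Kernel ((U' × X' × X) × X) X') [IsMarkovKernel κ]
    (x₀' : X') {μ : X' × Q → ProbabilityMeasure U'} (hμ : UniversallyMeasurable μ)
    {σ : X × Q → Q} (hσ : Measurable σ) :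
    UniversallyMeasurable (refinedTrans κ x₀' μ σ) :=
  fun m hm => (abstractStateKernel κ x₀').measurable.universallyMeasurable.bind_measure
    (fun _ => inferInstance) (universallyMeasurable_memoryLaw_comp hμ hσ) m hm

lemma isProbabilityMeasure_refinedTrans (κ : Kernel ((U' × X' × X) × X) X') [IsMarkovKernel κ]
    (x₀' : X') {μ : X' × Q → ProbabilityMeasure U'} (hμ : UniversallyMeasurable μ)
    {σ : X × Q → Q} (hσ : Measurable σ) (p : RefinedMemory X' U' X Q × X) :
    IsProbabilityMeasure (refinedTrans κ x₀' μ σ p) :=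
  isProbabilityMeasure_bind_of_aemeasurable
    ((universallyMeasurable_memoryLaw_comp hμ hσ).comp
      (g := fun x' => (p, x')) (by fun_prop) _ inferInstance)
    fun _ => inferInstance

/-- The law of the next concrete state, paired with the memory, when the input is drawn according
to the memory. -/
noncomputable def drawNext (M : GMDP X U Y) (Uv : U' × X' × X → ProbabilityMeasure U)
    (p : X × RefinedMemory X' U' X Q) : Measure (X × RefinedMemory X' U' X Q) :=
  (Uv p.2.2.1 : Measure U).bind fun u => (M.t (p.1, u)).map fun x => (x, p.2)

lemma measurable_map_prodMk {C : Type*} [MeasurableSpace C] (M : GMDP X U Y) :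
    Measurable fun p : (X × C) × U => (M.t (p.1.1, p.2)).map fun x => (x, p.1.2) := by
  have hM := M.isMarkov
  refine Measure.measurable_of_measurable_coe _ fun s hs => ?_
  let K : Kernel ((X × C) × U) X := M.t.comap (fun p => (p.1.1, p.2)) (by fun_prop)
  have h : ∀ p : (X × C) × U, ((M.t (p.1.1, p.2)).map fun x => (x, p.1.2)) s =
      K p (Prod.mk p ⁻¹' {r | (r.2, r.1.1.2) ∈ s}) := fun p => by
    rw [Measure.map_apply (by fun_prop) hs]; rfl
  simp_rw [h]
  exact Kernel.measurable_kernel_prodMk_left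
    (measurableSet_preimage (f := fun r : ((X × C) × U) × X => (r.2, r.1.1.2)) (by fun_prop) hs)

lemma universallyMeasurable_drawNext (M : GMDP X U Y) {Uv : U' × X' × X → ProbabilityMeasure U}
    (hUv : UniversallyMeasurable Uv) :
    UniversallyMeasurable (drawNext (Q := Q) M Uv) :=
  UniversallyMeasurable.bind (κ := fun p : X × RefinedMemory X' U' X Q => Uv p.2.2.1)
    (f := fun p => (M.t (p.1.1, p.2)).map fun x => (x, p.1.2))
    (hUv.comp (g := fun p : X × RefinedMemory X' U' X Q => p.2.2.1) (by fun_prop))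
    (measurable_map_prodMk M).universallyMeasurable

instance isProbabilityMeasure_drawNext (M : GMDP X U Y) (Uv : U' × X' × X → ProbabilityMeasure U)
    (p : X × RefinedMemory X' U' X Q) : IsProbabilityMeasure (drawNext M Uv p) := by
  have hM := M.isMarkov
  exact isProbabilityMeasure_bind_of_aemeasurable
    ((measurable_map_prodMk M).comp (measurable_prodMk_left (x := p))).aemeasurable
    fun _ => Measure.isProbabilityMeasure_map (by fun_prop)

lemma lintegral_drawNext (M : GMDP X U Y) (Uv : U' × X' × X → ProbabilityMeasure U)
    (p : X × RefinedMemory X' U' X Q) {f : X × RefinedMemory X' U' X Q → ℝ≥0∞}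
    (hf : UniversallyMeasurable f) :
    ∫⁻ s, f s ∂drawNext M Uv p = ∫⁻ x, f (x, p.2) ∂M.next p.1 (Uv p.2.2.1) := by
  have hM := M.isMarkov
  have hp : Measurable fun x : X => (x, p.2) := by fun_prop
  have h : Measurable fun u => M.t (p.1, u) := M.t.measurable.comp measurable_prodMk_left
  have h1 : Measurable fun u => (M.t (p.1, u)).map fun x => (x, p.2) :=
    (measurable_map_prodMk M).comp (measurable_prodMk_left (x := p))
  have h2 : ∀ u, IsProbabilityMeasure ((M.t (p.1, u)).map fun x => (x, p.2)) := fun _ =>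
    Measure.isProbabilityMeasure_map hp.aemeasurable
  have h3 : ∀ u, IsProbabilityMeasure (M.t (p.1, u)) := fun _ => inferInstance
  have h4 : UniversallyMeasurable fun x => f (x, p.2) := hf.comp hp
  rw [drawNext, GMDP.next, h.universallyMeasurable.lintegral_bind h3 h4,
    h1.universallyMeasurable.lintegral_bind h2 hf]
  refine lintegral_congr fun u => ?_
  exact lintegral_map' (hf _ (h2 u)) hp.aemeasurable

/-- One step of the concrete gMDP under the refined controller. -/
noncomputable def refinedStep (M : GMDP X U Y) (Uv : U' × X' × X → ProbabilityMeasure U)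
    (κ : Kernel ((U' × X' × X) × X) X') (x₀' : X') (μ : X' × Q → ProbabilityMeasure U')
    (σ : X × Q → Q) (s : X × RefinedMemory X' U' X Q) : Measure (X × RefinedMemory X' U' X Q) :=
  (refinedTrans κ x₀' μ σ (s.2, s.1)).bind fun c => drawNext M Uv (s.1, c)

/-- The integral of `f` after one step, given the current abstract state and location. -/
noncomputable def expectNext (M : GMDP X U Y) (Uv : U' × X' × X → ProbabilityMeasure U)
    (μ : X' × Q → ProbabilityMeasure U') (f : X × RefinedMemory X' U' X Q → ℝ≥0∞)
    (x : X) (x' : X') (q : Q) : ℝ≥0∞ :=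
  ∫⁻ u', ∫⁻ y, f (y, true, (u', x', x), q) ∂M.next x (Uv (u', x', x)) ∂(μ (x', q) : Measure U')

/-- Separates the draw of the abstract state, the only part of the step that depends on the old flag
and triple, from what follows. This lets the initial step and all later ones share one estimate for
`expectNext`. -/
lemma lintegral_refinedStep [MeasurableSingletonClass X'] [MeasurableSingletonClass U']
    [MeasurableSingletonClass X] [MeasurableSingletonClass Q]
    (M : GMDP X U Y) {Uv : U' × X' × X → ProbabilityMeasure U} (hUv : UniversallyMeasurable Uv)
    (κ : Kernel ((U' × X' × X) × X) X') [IsMarkovKernel κ] (x₀' : X')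
    {μ : X' × Q → ProbabilityMeasure U'} (hμ : UniversallyMeasurable μ) {σ : X × Q → Q}
    (hσ : Measurable σ) (x : X) (c : RefinedMemory X' U' X Q)
    {f : X × RefinedMemory X' U' X Q → ℝ≥0∞} (hf : UniversallyMeasurable f) :
    ∫⁻ s, f s ∂refinedStep M Uv κ x₀' μ σ (x, c) =
      ∫⁻ x', expectNext M Uv μ f x x' (σ (x, c.2.2)) ∂abstractStateKernel κ x₀' (c, x) := by
  have h1 : UniversallyMeasurable fun c' => drawNext (Q := Q) M Uv (x, c') :=
    (universallyMeasurable_drawNext M hUv).comp measurable_prodMk_left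
  have h2 : UniversallyMeasurable fun c' => ∫⁻ s, f s ∂drawNext (Q := Q) M Uv (x, c') :=
    h1.lintegral (fun _ => inferInstance) hf
  have h3 : UniversallyMeasurable fun x' => memoryLaw μ (x, x', σ (x, c.2.2)) :=
    (universallyMeasurable_memoryLaw_comp hμ hσ).comp (g := fun x' => ((c, x), x')) (by fun_prop)
  have := isProbabilityMeasure_refinedTrans κ x₀' hμ hσ (c, x)
  refine (h1.lintegral_bind (m := refinedTrans κ x₀' μ σ (c, x))
    (fun _ => inferInstance) hf).trans ?_
  refine (h3.lintegral_bind (m := abstractStateKernel κ x₀' (c, x))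
    (fun _ => inferInstance) h2).trans (lintegral_congr fun x' => ?_)
  rw [lintegral_memoryLaw μ _ h2]
  exact lintegral_congr fun u' => lintegral_drawNext M Uv _ hf

lemma universallyMeasurable_refinedStep (M : GMDP X U Y)
    {Uv : U' × X' × X → ProbabilityMeasure U} (hUv : UniversallyMeasurable Uv)
    (κ : Kernel ((U' × X' × X) × X) X') [IsMarkovKernel κ] (x₀' : X')
    {μ : X' × Q → ProbabilityMeasure U'} (hμ : UniversallyMeasurable μ) {σ : X × Q → Q}
    (hσ : Measurable σ) :
    UniversallyMeasurable (refinedStep M Uv κ x₀' μ σ) := by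
  have h1 : UniversallyMeasurable fun s : X × RefinedMemory X' U' X Q =>
      refinedTrans κ x₀' μ σ (s.2, s.1) :=
    (universallyMeasurable_refinedTrans κ x₀' hμ hσ).comp measurable_swap
  have h2 : UniversallyMeasurable
      fun p : (X × RefinedMemory X' U' X Q) × RefinedMemory X' U' X Q =>
        drawNext M Uv (p.1.1, p.2) :=
    (universallyMeasurable_drawNext M hUv).comp
      (g := fun p : (X × RefinedMemory X' U' X Q) × RefinedMemory X' U' X Q => (p.1.1, p.2))
      (by fun_prop)
  intro m hm
  exact h1.bind_measure
    (fun s => isProbabilityMeasure_refinedTrans κ x₀' hμ hσ (s.2, s.1)) h2 m hm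

lemma isProbabilityMeasure_refinedStep (M : GMDP X U Y)
    {Uv : U' × X' × X → ProbabilityMeasure U} (hUv : UniversallyMeasurable Uv)
    (κ : Kernel ((U' × X' × X) × X) X') [IsMarkovKernel κ] (x₀' : X')
    {μ : X' × Q → ProbabilityMeasure U'} (hμ : UniversallyMeasurable μ) {σ : X × Q → Q}
    (hσ : Measurable σ) (s : X × RefinedMemory X' U' X Q) :
    IsProbabilityMeasure (refinedStep M Uv κ x₀' μ σ s) := by
  have := isProbabilityMeasure_refinedTrans κ x₀' hμ hσ (s.2, s.1)
  exact isProbabilityMeasure_bind_of_aemeasurable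
    ((universallyMeasurable_drawNext M hUv).comp measurable_prodMk_left _ this)
    fun _ => inferInstance

/-- The location stored in the memory follows the automaton. -/
lemma refinedStep_location_ne [MeasurableSingletonClass X'] [MeasurableSingletonClass U']
    [MeasurableSingletonClass X] [MeasurableSingletonClass Q]
    (M : GMDP X U Y) {Uv : U' × X' × X → ProbabilityMeasure U} (hUv : UniversallyMeasurable Uv)
    (κ : Kernel ((U' × X' × X) × X) X') [IsMarkovKernel κ] (x₀' : X')
    {μ : X' × Q → ProbabilityMeasure U'} (hμ : UniversallyMeasurable μ) {σ : X × Q → Q}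
    (hσ : Measurable σ) (s : X × RefinedMemory X' U' X Q) :
    refinedStep M Uv κ x₀' μ σ s {s' | s'.2.2.2 ≠ σ (s.1, s.2.2.2)} = 0 := by
  have hs : MeasurableSet {s' : X × RefinedMemory X' U' X Q | s'.2.2.2 ≠ σ (s.1, s.2.2.2)} :=
    measurableSet_preimage (f := fun s' : X × RefinedMemory X' U' X Q => s'.2.2.2) (by fun_prop)
      (measurableSet_singleton (σ (s.1, s.2.2.2))).compl
  rw [← lintegral_indicator_one hs]
  have h := lintegral_refinedStep M hUv κ x₀' hμ hσ s.1 s.2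
    (measurable_one.indicator hs).universallyMeasurable
  exact h.trans (by simp [expectNext])

end Refinement

/-! ### Comparison of the robust operator with the controlled process -/

section Comparison

variable {X' U' X U Y Q AP : Type*} [MeasurableSpace X'] [MeasurableSpace U'] [MeasurableSpace X]
  [MeasurableSpace U]

/-- A lifting with conditional kernel `κ` of the abstract state given the concrete state transfers
integrals from the abstract to the concrete transition, up to `δ`. -/
lemma IsLifting.lintegral_le {R : Set (X' × X)} (hR : MeasurableSet R) {δ : ℝ≥0} {Δ : Measure X'}
    {Θ : Measure X} [SFinite Θ] {W : Measure (X' × X)} (hW : IsLifting R δ Δ Θ W) {κ : Kernel X X'}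
    [IsSFiniteKernel κ] (hκ : W.map Prod.swap = Θ ⊗ₘ κ) {g : X' → ℝ≥0∞} (hg : Measurable g)
    (hg1 : ∀ x', g x' ≤ 1) :
    ∫⁻ x', g x' ∂Δ ≤ ∫⁻ x, ∫⁻ x', R.indicator (fun p => g p.1) (x', x) ∂κ x ∂Θ + δ := by
  have := hW.isProbabilityMeasure
  have h1 : W.map Prod.fst = Δ := Measure.ext fun s hs => by
    rw [Measure.map_apply measurable_fst hs, ← hW.fst s hs, Set.prod_univ]
  -- This is the only source of `δ`: outside `R` the integrand is bounded by `1`.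
  have h2 : W Rᶜ ≤ δ := by
    rw [prob_compl_eq_one_sub hR]
    exact tsub_le_iff_left.2 (tsub_le_iff_right.1 hW.one_sub_le)
  have hi : Measurable (R.indicator fun p => g p.1) := (hg.comp measurable_fst).indicator hR
  have h3 : ∫⁻ p, R.indicator (fun p => g p.1) p ∂W =
      ∫⁻ x, ∫⁻ x', R.indicator (fun p => g p.1) (x', x) ∂κ x ∂Θ := by
    refine Eq.trans ?_ (Measure.lintegral_compProd (μ := Θ) (κ := κ) (hi.comp measurable_swap))
    rw [← hκ, lintegral_map (hi.comp measurable_swap) measurable_swap]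
    rfl
  rw [← h1, lintegral_map hg measurable_fst, ← h3, ← lintegral_add_compl _ hR,
    lintegral_indicator hR]
  refine add_le_add le_rfl ?_
  calc ∫⁻ p in Rᶜ, g p.1 ∂W ≤ ∫⁻ _ in Rᶜ, 1 ∂W := lintegral_mono fun p => hg1 p.1
    _ ≤ δ := by simpa using h2

/-- The conditional law of the first component of a kernel given the second component. -/
lemma exists_condKernel_swap [StandardBorelSpace X'] [Nonempty X'] [StandardBorelSpace X]
    {V : Type*} [MeasurableSpace V] (W : Kernel V (X' × X)) [IsMarkovKernel W] :
    ∃ κ : Kernel (V × X) X', IsMarkovKernel κ ∧ ∀ v, (W v).map Prod.swap =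
      (W v).map Prod.snd ⊗ₘ κ.comap (Prod.mk v) measurable_prodMk_left := by
  -- Conditional kernels condition on the first coordinate, so the concrete state is moved there.
  let W' : Kernel V (X × X') := W.map Prod.swap
  have hW' : IsMarkovKernel W' := Kernel.IsMarkovKernel.map _ measurable_swap
  refine ⟨W'.condKernel, inferInstance, fun v => ?_⟩
  have h := congrArg (fun k : Kernel V (X × X') => k v) (W'.disintegrate W'.condKernel)
  simp only [Kernel.compProd_apply_eq_compProd_sectR] at h
  rw [← Kernel.map_apply _ measurable_swap]
  refine h.symm.trans ?_
  congr 1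
  rw [Kernel.fst_apply, Kernel.map_apply _ measurable_swap,
    Measure.map_map measurable_fst measurable_swap]
  rfl

variable [MetricSpace Y] [MeasurableSpace Y]

/-- Used with `y` the output of a related concrete state: the location actually reached is then
among those the minimum ranges over. -/
lemma ambiguousSucc_of_dist_le (M : GMDP X U Y) (A : DFA (Set AP) Q) (L : Y → Set AP) (ε : ℝ≥0)
    (q : Q) (x : X) {y : Y} (hy : dist (M.h x) y ≤ ε) :
    A.step q (L y) ∈ ambiguousSucc M A L ε q x :=
  ⟨L y, ⟨y, by rwa [Set.mem_ofPred_eq, dist_comm], rfl⟩, rfl⟩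

lemma robustOp_iterate_le_one (M : GMDP X U Y) (A : DFA (Set AP) Q) (L : Y → Set AP) (ε δ : ℝ≥0)
    (μ : X × Q → ProbabilityMeasure U) (l : ℕ) (s : X × Q) :
    (robustOp M A L ε δ μ)^[l] 0 s ≤ 1 := by
  cases l with
  | zero => simp
  | succ l => rw [Function.iterate_succ_apply']; exact min_le_left _ _

lemma maxAccept_le_one {S : Type*} (A : DFA S Q) (q : Q) {v : ℝ≥0∞} (hv : v ≤ 1) :
    maxAccept A q v ≤ 1 :=
  max_le (Set.indicator_le_self A.accept (1 : Q → ℝ≥0∞) q) hv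

variable [MeasurableSpace Q]

/-- The states of the concrete gMDP under the refined controller whose label leads the automaton to
an accepting location. -/
def refinedAccept (X' U' : Type*) (M : GMDP X U Y) (A : DFA (Set AP) Q) (L : Y → Set AP) :
    Set (X × RefinedMemory X' U' X Q) :=
  {s | A.step s.2.2.2 (L (M.h s.1)) ∈ A.accept}

/-- The iterates of the robust operator bound from below the probability that the concrete gMDP
under the refined controller is accepted. -/
theorem robustOp_iterate_le_expectNext [StandardBorelSpace X'] [StandardBorelSpace U']
    [StandardBorelSpace X] [MeasurableSingletonClass Q] {M' : GMDP X' U' Y} {M : GMDP X U Y}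
    {A : DFA (Set AP) Q} {L : Y → Set AP} {ε δ : ℝ≥0}
    {Uv : U' × X' × X → ProbabilityMeasure U} (hUv : UniversallyMeasurable Uv)
    {R : Set (X' × X)} (hR : MeasurableSet R) {W : Kernel (U' × X' × X) (X' × X)}
    (hW : ∀ x' x, (x', x) ∈ R → dist (M'.h x') (M.h x) ≤ ε ∧
      ∀ u', IsLifting R δ (M'.t (x', u')) (M.next x (Uv (u', x', x))) (W (u', x', x)))
    {κ : Kernel ((U' × X' × X) × X) X'} [IsMarkovKernel κ]
    (hκ : ∀ v, (W v).map Prod.swap =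
      (W v).map Prod.snd ⊗ₘ κ.comap (Prod.mk v) measurable_prodMk_left) (x₀' : X')
    {μ : X' × Q → ProbabilityMeasure U'} (hμ : UniversallyMeasurable μ)
    (hσ : Measurable fun p : X × Q => A.step p.2 (L (M.h p.1)))
    (hacc : MeasurableSet (refinedAccept X' U' M A L)) (l : ℕ) {x' : X'} {x : X}
    (hx : (x', x) ∈ R) (q : Q) :
    (robustOp M' A L ε δ μ)^[l] 0 (x', q) ≤
      expectNext M Uv μ (hitProb (refinedStep M Uv κ x₀' μ fun p => A.step p.2 (L (M.h p.1)))
        (refinedAccept X' U' M A L) l) x x' q := by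
  set κ' := refinedStep M Uv κ x₀' μ fun p => A.step p.2 (L (M.h p.1))
  have hstep : UniversallyMeasurable κ' := universallyMeasurable_refinedStep M hUv κ x₀' hμ hσ
  have hprob := isProbabilityMeasure_refinedStep M hUv κ x₀' hμ hσ
  induction l generalizing x' x q with
  | zero => simp
  | succ l ih =>
    have hM' := M'.isMarkov
    have hM := M.isMarkov
    rw [Function.iterate_succ_apply']
    -- Both truncations are harmless for an upper bound on the iterate: the cap at `1` is dropped,
    -- and the truncated difference becomes an inequality with `δ` added on the right.
    refine (min_le_right _ _).trans (tsub_le_iff_right.2 ?_)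
    -- The integrand may be non-measurable and its integral is a lower integral, so a measurable
    -- minorant with the same integral replaces it.
    obtain ⟨g, hgm, hgf, hg⟩ := exists_measurable_le_lintegral_eq (M'.next x' (μ (x', q)))
      fun y' => ⨅ q' ∈ ambiguousSucc M' A L ε q y',
        maxAccept A q' ((robustOp M' A L ε δ μ)^[l] 0 (y', q'))
    -- The abstract output itself is a point of the `ε`-ball, so the infimum is not over the empty
    -- set, where it would be `∞`.
    have hg1 : ∀ y', g y' ≤ 1 := fun y' => (hgf y').trans <| (iInf₂_le _
      (ambiguousSucc_of_dist_le M' A L ε q y' (y := M'.h y') (by simp))).trans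
      (maxAccept_le_one A _ (robustOp_iterate_le_one M' A L ε δ μ l _))
    refine hg.le.trans ?_
    have ht : Measurable fun u' => M'.t (x', u') := M'.t.measurable.comp measurable_prodMk_left
    rw [GMDP.next, Measure.lintegral_bind ht.aemeasurable hgm.aemeasurable]
    -- Since `μ` gives probability measures, `δ` can be moved under the integral and the comparison
    -- made for each abstract input separately.
    have hδ : ∀ F : U' → ℝ≥0∞, ∫⁻ u', F u' ∂(μ (x', q) : Measure U') + δ =
        ∫⁻ u', (F u' + δ) ∂(μ (x', q) : Measure U') := fun F => by
      rw [lintegral_add_right _ measurable_const]; simp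
    rw [expectNext, hδ]
    refine lintegral_mono fun u' => ?_
    have hlift := (hW x' x hx).2 u'
    have hsnd : (W (u', x', x)).map Prod.snd = M.next x (Uv (u', x', x)) :=
      Measure.ext fun s hs => by
        rw [Measure.map_apply measurable_snd hs, ← hlift.snd s hs, Set.univ_prod]
    have hWp := hlift.isProbabilityMeasure
    have hnext : IsProbabilityMeasure (M.next x (Uv (u', x', x))) :=
      hsnd ▸ Measure.isProbabilityMeasure_map measurable_snd.aemeasurable
    have hdis := hκ (u', x', x)
    rw [hsnd] at hdis
    refine (hlift.lintegral_le hR hdis hgm hg1).trans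
      (add_le_add (lintegral_mono fun y => ?_) le_rfl)
    rw [Kernel.comap_apply]
    have hind : ∀ y', R.indicator (fun p => g p.1) (y', y) ≤ 1 := fun y' =>
      (Set.indicator_le_self R (fun p => g p.1) (y', y)).trans (hg1 y')
    -- The location reached depends on `y` only, so acceptance is decided before the abstract state
    -- is drawn. If it is not accepting, the indicator of `F` vanishes and only the previous iterate
    -- remains.
    by_cases hq : A.step q (L (M.h y)) ∈ A.accept
    · exact ((lintegral_mono hind).trans (by simp)).trans
        (hitProb_of_mem (s := (y, true, (u', x', x), q)) hq (l + 1))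
    · refine le_trans ?_ (le_max_right _ _)
      rw [lintegral_refinedStep M hUv κ x₀' hμ hσ y _
        (universallyMeasurable_hitProb hstep hprob hacc l), abstractStateKernel_true]
      refine lintegral_mono fun y' => ?_
      by_cases hy : (y', y) ∈ R
      swap
      · rw [Set.indicator_of_notMem hy]
        exact zero_le
      rw [Set.indicator_of_mem hy]
      refine (hgf y').trans ((iInf₂_le _
        (ambiguousSucc_of_dist_le M' A L ε q y' (hW y' y hy).1)).trans ?_)
      refine max_le (by simp [hq]) (ih hy _)

end Comparison

/-! ### Assembly of the strategy and the main theorem -/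

/-- A word is accepted by an automaton if some run on the word steps into an accepting location. -/
lemma DFA.acceptsWord_of_run {S Q : Type*} (A : DFA S Q) {w : ℕ → S} {r : ℕ → Q}
    (h0 : r 0 = A.start) (hr : ∀ n, r (n + 1) = A.step (r n) (w n)) {k : ℕ}
    (hk : A.step (r k) (w k) ∈ A.accept) : A.AcceptsWord w :=
  ⟨k + 1, r, h0, fun i _ => hr i, hr k ▸ hk⟩

/-- The refined controller as a control strategy. -/
noncomputable def refinedStrategy {X' U' X U Q : Type u}
    [TopologicalSpace X'] [PolishSpace X'] [MeasurableSpace X'] [BorelSpace X']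
    [TopologicalSpace U'] [PolishSpace U'] [MeasurableSpace U'] [BorelSpace U']
    [TopologicalSpace X] [PolishSpace X] [MeasurableSpace X] [BorelSpace X]
    [MeasurableSpace U] [Finite Q] [MeasurableSpace Q] [DiscreteMeasurableSpace Q]
    {Uv : U' × X' × X → ProbabilityMeasure U} (hUv : UniversallyMeasurable Uv)
    (κ : Kernel ((U' × X' × X) × X) X') [IsMarkovKernel κ] (x₀' : X')
    {μ : X' × Q → ProbabilityMeasure U'} (hμ : UniversallyMeasurable μ) {σ : X × Q → Q}
    (hσ : Measurable σ) (c₀ : RefinedMemory X' U' X Q) : ControlStrategy X U :=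
  -- The discrete topology on the finite set of locations makes the memory space Polish.
  letI : TopologicalSpace Q := ⊥
  haveI : DiscreteTopology Q := ⟨rfl⟩
  { XC := RefinedMemory X' U' X Q
    init := c₀
    trans := fun p => ⟨refinedTrans κ x₀' μ σ p, isProbabilityMeasure_refinedTrans κ x₀' hμ hσ p⟩
    universallyMeasurable_trans :=
      (universallyMeasurable_refinedTrans κ x₀' hμ hσ).toProbabilityMeasure _
    out := fun c => Uv c.2.1
    universallyMeasurable_out :=
      hUv.comp (g := fun c : RefinedMemory X' U' X Q => c.2.1) (by fun_prop) }

theorem mainTheorem1 {X' U' X U Q : Type u} {Y AP : Type*}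
    -- the Polish state and input spaces of the abstract gMDP
    [TopologicalSpace X'] [PolishSpace X'] [MeasurableSpace X'] [BorelSpace X']
    [TopologicalSpace U'] [PolishSpace U'] [MeasurableSpace U'] [BorelSpace U']
    -- the Polish state and input spaces of the concrete gMDP
    [TopologicalSpace X] [PolishSpace X] [MeasurableSpace X] [BorelSpace X]
    [TopologicalSpace U] [PolishSpace U] [MeasurableSpace U] [BorelSpace U]
    -- the common metric output space
    [MetricSpace Y] [MeasurableSpace Y] [BorelSpace Y]
    -- atomic propositions, labelling, formula and an automaton for it
    [Finite AP] [Finite Q] [MeasurableSpace Q] [DiscreteMeasurableSpace Q]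
    (L : Y → Set AP) (hL : MeasurableLabelling L)
    (ψ : ScLTL AP) (A : DFA (Set AP) Q) (hA : A.Recognizes ψ)
    (ε δ : ℝ≥0)
    -- the abstract gMDP and a stationary Markov policy on its product with the automaton
    (M' : GMDP X' U' Y) (μ : StationaryPolicy (M'.product A L hL))
    -- any concrete gMDP that simulates the abstract one
    (M : GMDP X U Y) (hM : StochasticallySimulatedBy ε δ M' M) :
    ∃ (C : ControlStrategy X U) (P : Measure (ℕ → X × C.XC)),
      C.IsExecutionLaw M P ∧
        robustSatProb M' A L ε δ μ.toFun ≤ P {ω | ψ.Sat fun t => L (M.h (ω t).1)} := by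
  obtain ⟨Uv, R, W, hUv, hR, hWm, h0R, hW⟩ := hM
  obtain ⟨μ, hμ⟩ := μ
  have : Nonempty X' := ⟨M'.x0⟩
  obtain ⟨κ, hκm, hκ⟩ := exists_condKernel_swap W
  obtain ⟨u₀⟩ : Nonempty U' := (μ (M'.x0, A.start) : Measure U').nonempty_of_neZero
  set σ : X × Q → Q := fun p => A.step p.2 (L (M.h p.1))
  have hσ : Measurable σ := measurable_snd.comp (measurable_dfa_step A hL M.measurable_h)
  have hacc : MeasurableSet (refinedAccept X' U' M A L) :=
    measurableSet_preimage (f := fun s : X × RefinedMemory X' U' X Q => σ (s.1, s.2.2.2))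
      (by fun_prop) (MeasurableSet.of_discrete (s := A.accept))
  -- With the flag `false` the triple is never read, so `u₀` is arbitrary. The stored location lags
  -- by one label: it is `A.start`, before the label of `M.x0` is read.
  let c₀ : RefinedMemory X' U' X Q := (false, (u₀, M'.x0, M.x0), A.start)
  set κ' := refinedStep M Uv κ M'.x0 μ σ
  have hstep : UniversallyMeasurable κ' := universallyMeasurable_refinedStep M hUv κ M'.x0 hμ hσ
  have hprob : ∀ s, IsProbabilityMeasure (κ' s) :=
    isProbabilityMeasure_refinedStep M hUv κ M'.x0 hμ hσ
  obtain ⟨P, hP, hP0, hPt⟩ := exists_chainLaw hstep hprob (M.x0, c₀)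
  -- The step of this strategy unfolds to `refinedStep`, so the chain law is an execution law by
  -- definition.
  refine ⟨refinedStrategy hUv κ M'.x0 hμ hσ c₀, P, ⟨hP, hP0, hPt⟩, ?_⟩
  have hlow : robustSatProb M' A L ε δ μ ≤ P {ω | ∃ k, ω k ∈ refinedAccept X' U' M A L} := by
    have hhit := hitProb_le_measure hstep hprob hPt hP0 hacc
    refine (iInf₂_le (A.step A.start (L (M.h M.x0)))
      (ambiguousSucc_of_dist_le M' A L ε A.start M'.x0 (hW _ _ h0R).1)).trans (max_le ?_ ?_)
    · refine le_trans ?_ (hhit 0)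
      exact le_rfl
    -- The horizon is `l + 1` because the strategy's first step draws the abstract state (here
    -- `M'.x0`) and the first input, after which `expectNext` looks `l` steps ahead.
    · refine iSup_le fun l => le_trans ?_ (hhit (l + 1))
      refine le_trans ?_ (le_max_right _ _)
      rw [lintegral_refinedStep M hUv κ M'.x0 hμ hσ _ _
        (universallyMeasurable_hitProb hstep hprob hacc l), abstractStateKernel_false,
        lintegral_dirac]
      exact robustOp_iterate_le_expectNext hUv hR hW hκ M'.x0 hμ hσ hacc l h0R _
  have hinit : ∀ᵐ ω ∂P, (ω 0).2.2.2 = A.start := by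
    have h1 : ∀ᵐ s ∂P.map (fun ω => ω 0), s = (M.x0, c₀) := by
      rw [hP0, ae_dirac_eq, eventually_pure]
    filter_upwards [ae_of_ae_map (measurable_pi_apply 0).aemeasurable h1] with ω hω
    rw [hω]
  have hrun : ∀ᵐ ω ∂P, ∀ n, (ω (n + 1)).2.2.2 = σ ((ω n).1, (ω n).2.2.2) := by
    refine ae_all_iff.2 fun n => ?_
    -- The transition identity covers only events of the form history in `D`, next state in `B`.
    -- Fixing the value `q` of the predicted location gives this form, and finitely many `q`
    -- suffice.
    have h1 : ∀ q : Q, ∀ᵐ ω ∂P, σ ((ω n).1, (ω n).2.2.2) = q → (ω (n + 1)).2.2.2 = q := by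
      intro q
      let D : Set (Finset.Iic n → X × RefinedMemory X' U' X Q) :=
        {w | σ ((w ⟨n, by simp⟩).1, (w ⟨n, by simp⟩).2.2.2) = q}
      have hD : MeasurableSet D := measurableSet_preimage
        (f := fun w : Finset.Iic n → X × RefinedMemory X' U' X Q =>
          σ ((w ⟨n, by simp⟩).1, (w ⟨n, by simp⟩).2.2.2)) (by fun_prop) (measurableSet_singleton q)
      have hB : MeasurableSet {s : X × RefinedMemory X' U' X Q | s.2.2.2 ≠ q} :=
        measurableSet_preimage (f := fun s : X × RefinedMemory X' U' X Q => s.2.2.2) (by fun_prop)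
          (measurableSet_singleton q).compl
      have hD' : MeasurableSet {ω : ℕ → X × RefinedMemory X' U' X Q |
          (fun i : Finset.Iic n => ω i) ∈ D} :=
        measurableSet_preimage (f := fun (ω : ℕ → X × RefinedMemory X' U' X Q)
          (i : Finset.Iic n) => ω i) (by fun_prop) hD
      have h2 := hPt n D _ hD hB
      rw [setLIntegral_congr_fun (g := fun _ => 0) hD' fun ω hω => by
        have h3 := refinedStep_location_ne M hUv κ M'.x0 hμ hσ (ω n)
        have h4 : σ ((ω n).1, (ω n).2.2.2) = q := hω
        rwa [h4] at h3] at h2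
      rw [lintegral_zero] at h2
      rw [ae_iff]
      refine measure_mono_null (fun ω hω => ?_) h2
      exact Classical.not_imp.1 hω
    filter_upwards [ae_all_iff.2 h1] with ω hω
    exact hω _ rfl
  refine hlow.trans (measure_mono_ae ?_)
  filter_upwards [hinit, hrun] with ω h0 h1
  rintro ⟨k, hk⟩
  exact (hA _).2 (A.acceptsWord_of_run (r := fun n => (ω n).2.2.2) h0 h1 hk)
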